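/- Let $m\ge r$ be non-negative integers and let $V=\{X\in\mathbb{C}^{m\times r}:\bar X'X=I_r\}$ be the complex Stiefel manifold, where $\bar X'$ denotes the conjugate transpose, with its normalized invariant measure $[\mathrm{d}X]$ of total mass one (the $U(m)$-invariant probability measure). For $Z\in\mathbb{C}^{m\times r}$ of full column rank the orientation of $Z$ is $H_Z=Z(\bar Z'Z)^{-1/2}\in V$. For a Hermitian positive definite $m\times m$ matrix $P$, $\mathrm{CMACG}(P)$ denotes the distribution on $V$ whose density with respect to $[\mathrm{d}X]$ is $$H\mapsto |P|^{-r}\,\bigl|\bar H'P^{-1}H\bigr|^{-m},$$ where $|\cdot|$ is the determinant. Let $Z$ be a random complex $m\times r$ matrix which has a density $f_Z$ with respect to Lebesgue measure on $\mathbb{C}^{m\times r}$, and suppose that $f_Z$ is invariant under right unitary transformations: for every unitary $r\times r$ matrix $Q$, $f_Z(XQ)=f_Z(X)$ for almost every $X$. Let $B\in\mathbb{C}^{m\times m}$ be non-singular and let $P$ be a Hermitian positive definite $m\times m$ matrix. If the orientation $H_Z$ of $Z$ has the $\mathrm{CMACG}(P)$ distribution, then the orientation $H_Y$ of $Y=BZ$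 has the $\mathrm{CMACG}(BP\bar B')$ distribution. -/

import Mathlib

open MeasureTheory ProbabilityTheory Matrix
open scoped ENNReal ComplexOrder MatrixOrder

namespace CMACG

/-- The product (Borel) σ-algebra on complex `a × b` matrices. -/
noncomputable instance instMeasurableSpaceMatrix (a b : ℕ) : MeasurableSpace (Matrix (Fin a) (Fin b) ℂ) :=
  inferInstanceAs (MeasurableSpace (Fin a → Fin b → ℂ))

instance instBorelSpaceMatrix (a b : ℕ) : BorelSpace (Matrix (Fin a) (Fin b) ℂ) :=
  inferInstanceAs (BorelSpace (Fin a → Fin b → ℂ))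

/-- Lebesgue measure `(dZ)` on `ℂ^{m × r} ≅ ℝ^{2mr}`: the product, over all entries, of
two-dimensional Lebesgue measure on `ℂ`. -/
noncomputable def lebesgue (m r : ℕ) : Measure (Matrix (Fin m) (Fin r) ℂ) :=
  Measure.map Matrix.of (volume : Measure (Fin m → Fin r → ℂ))

/-- The complex Stiefel manifold: `m × r` complex matrices with `X̄' X = I_r`. -/
def stiefel (m r : ℕ) : Set (Matrix (Fin m) (Fin r) ℂ) := {X | Xᴴ * X = 1}

/-- The orientation `H_Z = Z (Z̄' Z)^{-1/2}` in the polar decomposition of `Z`. -/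
noncomputable def orientation {m r : ℕ} (Z : Matrix (Fin m) (Fin r) ℂ) :
    Matrix (Fin m) (Fin r) ℂ :=
  Z * (CFC.sqrt (Zᴴ * Z))⁻¹

instance instCompactSpaceUnitary (m : ℕ) : CompactSpace (unitaryGroup (Fin m) ℂ) := by
  have hK : IsCompact (Set.univ.pi fun _ => Set.univ.pi fun _ => Metric.closedBall (0 : ℂ) 1 :
      Set (Fin m → Fin m → ℂ)) :=
    isCompact_univ_pi fun _ => isCompact_univ_pi fun _ => isCompact_closedBall _ _
  have hC : IsClosed (unitaryGroup (Fin m) ℂ : Set (Matrix (Fin m) (Fin m) ℂ)) :=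
    isClosed_unitary
  refine isCompact_iff_compactSpace.mp (IsCompact.of_isClosed_subset
    (X := Matrix (Fin m) (Fin m) ℂ) hK hC fun U hU i _ j _ => ?_)
  simpa using entry_norm_bound_of_unitary hU i j

instance instBorelSpaceUnitary (m : ℕ) : BorelSpace (unitaryGroup (Fin m) ℂ) :=
  inferInstanceAs (BorelSpace {U : Matrix (Fin m) (Fin m) ℂ // U ∈ unitaryGroup (Fin m) ℂ})

/-- The Haar probability measure on the unitary group `U(m)`. -/
noncomputable def unitaryHaar (m : ℕ) : Measure (unitaryGroup (Fin m) ℂ) :=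
  Measure.haarMeasure ⊤

/-- The first `r` columns of an `m × m` unitary matrix. -/
def firstColumns {m r : ℕ} (h : r ≤ m) (U : unitaryGroup (Fin m) ℂ) :
    Matrix (Fin m) (Fin r) ℂ :=
  (U : Matrix (Fin m) (Fin m) ℂ).submatrix id (Fin.castLE h)

/-- The normalized invariant measure `[dX]` of unit mass on the complex Stiefel manifold
`V = U(m) / U(m - r)`: the image of the Haar probability measure on `U(m)` under the projection
onto the first `r` columns.  It is regarded as a measure on all `m × r` matrices; that it is a
probability measure, is concentrated on `stiefel m r` and is invariant under the transitive action
of `U(m)` is checked below. -/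
noncomputable def stiefelMeasure {m r : ℕ} (h : r ≤ m) : Measure (Matrix (Fin m) (Fin r) ℂ) :=
  (unitaryHaar m).map (firstColumns h)

theorem measurable_firstColumns {m r : ℕ} (h : r ≤ m) : Measurable (firstColumns h) :=
  (continuous_subtype_val.matrix_submatrix id (Fin.castLE h)).measurable

instance instIsProbabilityMeasureUnitaryHaar (m : ℕ) :
    IsProbabilityMeasure (unitaryHaar m) :=
  ⟨by simpa [unitaryHaar] using
    Measure.haarMeasure_self (K₀ := (⊤ : TopologicalSpace.PositiveCompacts
      (unitaryGroup (Fin m) ℂ)))⟩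

instance instIsProbabilityMeasureStiefelMeasure {m r : ℕ} (h : r ≤ m) :
    IsProbabilityMeasure (stiefelMeasure h) :=
  Measure.isProbabilityMeasure_map (measurable_firstColumns h).aemeasurable

theorem firstColumns_mem_stiefel {m r : ℕ} (h : r ≤ m) (U : unitaryGroup (Fin m) ℂ) :
    firstColumns h U ∈ stiefel m r := by
  have hU : (U : Matrix (Fin m) (Fin m) ℂ)ᴴ * (U : Matrix (Fin m) (Fin m) ℂ) = 1 :=
    mem_unitaryGroup_iff'.mp U.2
  have hinj : Function.Injective (Fin.castLE h) := Fin.castLE_injective h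
  change ((U : Matrix (Fin m) (Fin m) ℂ).submatrix id (Fin.castLE h))ᴴ *
    (U : Matrix (Fin m) (Fin m) ℂ).submatrix id (Fin.castLE h) = 1
  rw [conjTranspose_submatrix, ← submatrix_mul _ _ _ _ _ Function.bijective_id, hU,
    submatrix_one _ hinj]

theorem stiefelMeasure_compl_stiefel {m r : ℕ} (h : r ≤ m) :
    stiefelMeasure h (stiefel m r)ᶜ = 0 := by
  have hm : MeasurableSet (stiefel m r) :=
    (isClosed_eq (f := fun X : Matrix (Fin m) (Fin r) ℂ => Xᴴ * X) (by fun_prop)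
      continuous_const).measurableSet
  rw [stiefelMeasure, Measure.map_apply (measurable_firstColumns h) hm.compl]
  convert measure_empty (μ := unitaryHaar m)
  ext U
  simp [firstColumns_mem_stiefel h U]

theorem map_mul_left_stiefelMeasure {m r : ℕ} (h : r ≤ m) (V : unitaryGroup (Fin m) ℂ) :
    (stiefelMeasure h).map (fun X => (V : Matrix (Fin m) (Fin m) ℂ) * X) = stiefelMeasure h := by
  have hV : Measurable (fun X : Matrix (Fin m) (Fin r) ℂ =>
      (V : Matrix (Fin m) (Fin m) ℂ) * X) :=
    Continuous.measurable (by fun_prop)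
  have hH : (unitaryHaar m).map (fun U => V * U) = unitaryHaar m := by
    unfold unitaryHaar
    exact map_mul_left_eq_self _ V
  have hVm : Measurable (fun U : unitaryGroup (Fin m) ℂ => V * U) :=
    (continuous_const.mul continuous_id).measurable
  conv_rhs => rw [stiefelMeasure, ← hH, Measure.map_map (measurable_firstColumns h) hVm]
  rw [stiefelMeasure, Measure.map_map hV (measurable_firstColumns h)]
  rfl

/-- The complex matrix angular central Gaussian distribution with parameter `P`: the distribution
on the complex Stiefel manifold whose density with respect to the normalized invariant measure is
`H ↦ |P|^{-r} |H̄' P⁻¹ H|^{-m}`.  For positive definite `P` and `H` on the Stiefel manifold both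
determinants are positive real numbers, so taking real parts only changes their type. -/
noncomputable def cmacg {m r : ℕ} (h : r ≤ m) (P : Matrix (Fin m) (Fin m) ℂ) :
    Measure (Matrix (Fin m) (Fin r) ℂ) :=
  (stiefelMeasure h).withDensity fun H =>
    ENNReal.ofReal ((P.det.re ^ r)⁻¹ * ((Hᴴ * P⁻¹ * H).det.re ^ m)⁻¹)

end CMACG

namespace CMACG

variable {m r : ℕ}

/-! The orientation of `B Z` is not a function of `H_Z`. Writing `Z = H_Z S` with `S` the positive
root of the Gram matrix, the orientations of `B Z = (B H_Z) S` and of `B H_Z` differ by a right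
unitary factor depending on `Z`. Right invariance of the density of `Z` removes this ambiguity: a
test function `g` of the orientation of `B Z` may be replaced by its average over the right action
of `U(r)`, and this average does not see the factor. The law of `H_Z` then suffices, and the average
can be undone because CMACG laws are themselves right unitarily invariant.

What remains is a change of variables for the map sending `H` to the orientation of `B H`, needed
only for right-invariant functions. It is derived from Lebesgue measure, without differential forms,
as `lintegral_stiefelMeasure_comp_mul_left`: if `ψ` scales by `|det T|^{-2m}` under `X ↦ X T`, then
replacing `ψ(X)` by `ψ(B X)` multiplies its Stiefel integral by `|det B|^{-2r}`. Such an integral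
is, up to a constant, the Lebesgue integral of `ψ` against a cut-off weight in `X̄'X`. The
substitution by `B` turns that weight into one in `X̄'AX`, and `glMass_mul_lintegral_sandwich` shows
that the integral does not depend on `A`: insert a Haar integral over `GL(r, ℂ)`, exchange the
integrals, and use that this group is unimodular. The CMACG density has exactly the required
homogeneity, and its behaviour under `B` supplies the matching factor `|det B|^{-2r}`. -/

/-! ### Lebesgue measure and linear changes of variables. -/

theorem lintegral_lebesgue {m r : ℕ} (g : Matrix (Fin m) (Fin r) ℂ → ℝ≥0∞) :
    ∫⁻ X, g X ∂lebesgue m r = ∫⁻ x : Fin m → Fin r → ℂ, g (Matrix.of x) :=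
  congrArg (fun μ : Measure (Fin m → Fin r → ℂ) => ∫⁻ x, g (Matrix.of x) ∂μ) Measure.map_id

theorem lebesgue_eq_volume (m r : ℕ) :
    lebesgue m r = (volume : Measure (Fin m → Fin r → ℂ)) :=
  Measure.map_id

instance instIsAddHaarMeasureVolumePi (m r : ℕ) :
    (volume : Measure (Fin m → Fin r → ℂ)).IsAddHaarMeasure :=
  have : (volume : Measure (Fin r → ℂ)).IsAddHaarMeasure := inferInstance
  Measure.pi.isAddHaarMeasure _

instance instSigmaFiniteLebesgue (m r : ℕ) : SigmaFinite (lebesgue m r) := by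
  rw [lebesgue_eq_volume]
  exact inferInstanceAs (SigmaFinite (volume : Measure (Fin m → Fin r → ℂ)))

instance instIsOpenPosMeasureLebesgue (m r : ℕ) : (lebesgue m r).IsOpenPosMeasure := by
  rw [lebesgue_eq_volume]
  exact (instIsAddHaarMeasureVolumePi m r).toIsOpenPosMeasure

instance instIsFiniteMeasureOnCompactsLebesgue (m r : ℕ) :
    IsFiniteMeasureOnCompacts (lebesgue m r) := by
  rw [lebesgue_eq_volume]
  exact inferInstanceAs (IsFiniteMeasureOnCompacts (volume : Measure (Fin m → Fin r → ℂ)))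

/-- Change of variables in Lebesgue measure under a complex-linear automorphism. -/
theorem lintegral_lebesgue_comp_linearMap {m r : ℕ}
    (L : Matrix (Fin m) (Fin r) ℂ →ₗ[ℂ] Matrix (Fin m) (Fin r) ℂ) (hL : LinearMap.det L ≠ 0)
    {g : Matrix (Fin m) (Fin r) ℂ → ℝ≥0∞} (hg : Measurable g) :
    ∫⁻ X, g (L X) ∂lebesgue m r =
      ENNReal.ofReal (‖LinearMap.det L‖ ^ 2)⁻¹ * ∫⁻ X, g X ∂lebesgue m r := by
  set e : (Fin m → Fin r → ℂ) ≃ₗ[ℂ] Matrix (Fin m) (Fin r) ℂ := ofLinearEquiv ℂ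
  set F : (Fin m → Fin r → ℂ) →ₗ[ℂ] (Fin m → Fin r → ℂ) :=
    (e.symm : _ →ₗ[ℂ] _) ∘ₗ L ∘ₗ (e.symm.symm : _ →ₗ[ℂ] _) with hF
  -- The real determinant of a complex-linear map is the norm from `ℂ` to `ℝ` of its complex
  -- determinant; hence the exponent 2.
  have hdet : LinearMap.det (F.restrictScalars ℝ) = ‖LinearMap.det L‖ ^ 2 := by
    rw [LinearMap.det_restrictScalars, hF, LinearMap.det_conj, Algebra.norm_complex_apply,
      Complex.normSq_eq_norm_sq]
  have hne : LinearMap.det (F.restrictScalars ℝ) ≠ 0 := by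
    rw [hdet]; positivity
  have hmap := Measure.map_linearMap_addHaar_eq_smul_addHaar
    (volume : Measure (Fin m → Fin r → ℂ)) hne
  have hgm : Measurable fun x : Fin m → Fin r → ℂ => g (Matrix.of x) := hg
  have hFm : Measurable (F.restrictScalars ℝ) :=
    (LinearMap.continuous_of_finiteDimensional _).measurable
  rw [lintegral_lebesgue, lintegral_lebesgue]
  have h := congrArg (fun μ => ∫⁻ x, g (Matrix.of x) ∂μ) hmap
  rw [lintegral_map hgm hFm, lintegral_smul_measure, hdet, abs_of_nonneg (by positivity)] at h
  exact h

/-- Each of the `m` rows is transformed separately by `Tᵀ`, so the map is block diagonal with `m`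
equal blocks. -/
theorem det_mulRightLinearMap {m r : ℕ} (T : Matrix (Fin r) (Fin r) ℂ) :
    LinearMap.det (mulRightLinearMap (Fin m) ℂ T) = T.det ^ m := by
  set e : (Fin m → Fin r → ℂ) ≃ₗ[ℂ] Matrix (Fin m) (Fin r) ℂ := ofLinearEquiv ℂ
  have h : mulRightLinearMap (Fin m) ℂ T = (e : _ →ₗ[ℂ] _) ∘ₗ
      (LinearMap.pi fun i => (toLin' Tᵀ).comp (LinearMap.proj i) :
        (Fin m → Fin r → ℂ) →ₗ[ℂ] (Fin m → Fin r → ℂ)) ∘ₗ (e.symm : _ →ₗ[ℂ] _) := by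
    refine LinearMap.ext fun X => ?_
    ext i j
    simp [e, mulVec, dotProduct, Matrix.mul_apply, mul_comm]
  rw [h, LinearMap.det_conj, LinearMap.det_pi]
  simp

theorem det_mulLeftLinearMap {m r : ℕ} (B : Matrix (Fin m) (Fin m) ℂ) :
    LinearMap.det (mulLeftLinearMap (Fin r) ℂ B) = B.det ^ r := by
  set e := transposeLinearEquiv (Fin r) (Fin m) ℂ ℂ
  have h : mulLeftLinearMap (Fin r) ℂ B = (e : _ →ₗ[ℂ] _) ∘ₗ
      mulRightLinearMap (Fin r) ℂ Bᵀ ∘ₗ (e.symm : _ →ₗ[ℂ] _) := by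
    ext X i j
    simp [e, ← Matrix.transpose_mul]
  rw [h, LinearMap.det_conj, det_mulRightLinearMap, det_transpose]

theorem lintegral_lebesgue_mul_right {m r : ℕ} {T : Matrix (Fin r) (Fin r) ℂ} (hT : T.det ≠ 0)
    {g : Matrix (Fin m) (Fin r) ℂ → ℝ≥0∞} (hg : Measurable g) :
    ∫⁻ X, g (X * T) ∂lebesgue m r =
      ENNReal.ofReal (‖T.det‖ ^ (2 * m))⁻¹ * ∫⁻ X, g X ∂lebesgue m r := by
  have hd := det_mulRightLinearMap (m := m) T
  have h := lintegral_lebesgue_comp_linearMap (mulRightLinearMap (Fin m) ℂ T)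
    (by rw [hd]; exact pow_ne_zero _ hT) hg
  rw [hd, norm_pow, ← pow_mul, mul_comm m 2] at h
  exact h

theorem lintegral_lebesgue_mul_left {m r : ℕ} {B : Matrix (Fin m) (Fin m) ℂ} (hB : B.det ≠ 0)
    {g : Matrix (Fin m) (Fin r) ℂ → ℝ≥0∞} (hg : Measurable g) :
    ∫⁻ X, g (B * X) ∂lebesgue m r =
      ENNReal.ofReal (‖B.det‖ ^ (2 * r))⁻¹ * ∫⁻ X, g X ∂lebesgue m r := by
  have hd := det_mulLeftLinearMap (r := r) B
  have h := lintegral_lebesgue_comp_linearMap (mulLeftLinearMap (Fin r) ℂ B)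
    (by rw [hd]; exact pow_ne_zero _ hB) hg
  rw [hd, norm_pow, ← pow_mul, mul_comm r 2] at h
  exact h

/-! ### Haar measure on the unitary group and its action on frames. -/

/-- A right translate of Haar measure is again a left Haar probability measure, so uniqueness
applies. -/
instance instIsMulRightInvariantUnitaryHaar (m : ℕ) : (unitaryHaar m).IsMulRightInvariant := by
  have : (unitaryHaar m).IsHaarMeasure := by unfold unitaryHaar; infer_instance
  refine ⟨fun V => ?_⟩
  have : IsProbabilityMeasure (Measure.map (· * V) (unitaryHaar m)) :=
    Measure.isProbabilityMeasure_map (by fun_prop)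
  have : (Measure.map (· * V) (unitaryHaar m)).IsHaarMeasure := by
    exact Measure.isHaarMeasure_map_mul_right _ V
  exact Measure.isHaarMeasure_eq_of_isProbabilityMeasure _ _

/-- Every orthonormal `r`-frame consists of the first columns of a unitary matrix. -/
theorem exists_firstColumns_eq {m r : ℕ} (h : r ≤ m) {H : Matrix (Fin m) (Fin r) ℂ}
    (hH : H ∈ stiefel m r) : ∃ U : unitaryGroup (Fin m) ℂ, firstColumns h U = H := by
  -- The zero padding is harmless: orthonormality is asked only on the first `r` indices, and the
  -- extended basis need agree with `v` only there.
  let v : Fin m → EuclideanSpace ℂ (Fin m) := fun j =>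
    if hj : j.1 < r then WithLp.toLp 2 fun i => H i ⟨j, hj⟩ else 0
  let s : Set (Fin m) := {j | j.1 < r}
  have hinner (a b : Fin r) : ∑ i, star (H i a) * H i b = if a = b then 1 else 0 := by
    simpa [Matrix.mul_apply, Matrix.one_apply] using congrFun (congrFun hH a) b
  have hv : Orthonormal ℂ (s.domRestrict v) := by
    rw [orthonormal_iff_ite]
    rintro ⟨a, ha : a.1 < r⟩ ⟨b, hb : b.1 < r⟩
    simp only [Set.domRestrict_apply, v, dif_pos ha, dif_pos hb, PiLp.inner_apply,
      RCLike.inner_apply]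
    have h := hinner ⟨a, ha⟩ ⟨b, hb⟩
    simp only [Fin.ext_iff, Subtype.ext_iff] at h ⊢
    rw [← h]
    exact Finset.sum_congr rfl fun i _ => mul_comm _ _
  obtain ⟨b, hb⟩ := hv.exists_orthonormalBasis_extension_of_card_eq (by simp)
  have hU : (Matrix.of fun i j => b j i) ∈ unitaryGroup (Fin m) ℂ := by
    rw [mem_unitaryGroup_iff']
    ext i j
    have := orthonormal_iff_ite.mp b.orthonormal i j
    rw [PiLp.inner_apply] at this
    rw [Matrix.mul_apply, Matrix.one_apply, ← this]
    exact Finset.sum_congr rfl fun k _ => mul_comm _ _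
  refine ⟨⟨_, hU⟩, ?_⟩
  ext i j
  have hj : (Fin.castLE h j).1 < r := j.2
  simp [firstColumns, hb _ (show Fin.castLE h j ∈ s from hj), v]

/-- By transitivity `H` is the first columns of some unitary `V`, so `U H` is the first columns of
`U V`, and right invariance of Haar measure absorbs `V`. In particular the orbit integral is the
same for every frame. -/
theorem lintegral_unitaryHaar_mul {m r : ℕ} (h : r ≤ m) {H : Matrix (Fin m) (Fin r) ℂ}
    (hH : H ∈ stiefel m r) {g : Matrix (Fin m) (Fin r) ℂ → ℝ≥0∞} (hg : Measurable g) :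
    ∫⁻ U, g ((U : Matrix (Fin m) (Fin m) ℂ) * H) ∂unitaryHaar m =
      ∫⁻ X, g X ∂stiefelMeasure h := by
  obtain ⟨V, rfl⟩ := exists_firstColumns_eq h hH
  rw [stiefelMeasure, lintegral_map hg (measurable_firstColumns h),
    ← lintegral_mul_right_eq_self (μ := unitaryHaar m) (fun U => g (firstColumns h U)) V]
  rfl

/-! ### Full column rank and the polar decomposition. -/

theorem posDef_of_det_gram_ne_zero {X : Matrix (Fin m) (Fin r) ℂ} (hX : (Xᴴ * X).det ≠ 0) :
    (Xᴴ * X).PosDef :=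
  (posSemidef_conjTranspose_mul_self X).posDef_iff_isUnit.mpr
    ((isUnit_iff_isUnit_det _).mpr (isUnit_iff_ne_zero.mpr hX))

theorem mulVec_injective_iff_det_gram_ne_zero {X : Matrix (Fin m) (Fin r) ℂ} :
    Function.Injective X.mulVec ↔ (Xᴴ * X).det ≠ 0 := by
  refine ⟨fun h => (PosDef.conjTranspose_mul_self X h).isUnit.map detMonoidHom |>.ne_zero,
    fun h x y hxy => ?_⟩
  have hinj := mulVec_injective_iff_isUnit.mpr
    ((isUnit_iff_isUnit_det _).mpr (isUnit_iff_ne_zero.mpr h))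
  apply hinj
  simp only [← mulVec_mulVec, hxy]

/-- The sandwich `X̄' A X` of a positive definite `A` is non-singular exactly when `X` has full
column rank. -/
theorem det_conjTranspose_mul_mul_ne_zero_iff {A : Matrix (Fin m) (Fin m) ℂ} (hA : A.PosDef)
    {X : Matrix (Fin m) (Fin r) ℂ} : (Xᴴ * A * X).det ≠ 0 ↔ (Xᴴ * X).det ≠ 0 := by
  refine ⟨fun h => mulVec_injective_iff_det_gram_ne_zero.mp fun x y hxy => ?_, fun h => ?_⟩
  · have hinj := mulVec_injective_iff_isUnit.mpr
      ((isUnit_iff_isUnit_det _).mpr (isUnit_iff_ne_zero.mpr h))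
    apply hinj
    simp only [← mulVec_mulVec, hxy]
  · exact ((hA.conjTranspose_mul_mul_same
      (mulVec_injective_iff_det_gram_ne_zero.mpr h)).isUnit.map detMonoidHom).ne_zero

theorem det_gram_mul_left_ne_zero_iff {B : Matrix (Fin m) (Fin m) ℂ} (hB : B.det ≠ 0)
    {X : Matrix (Fin m) (Fin r) ℂ} :
    ((B * X)ᴴ * (B * X)).det ≠ 0 ↔ (Xᴴ * X).det ≠ 0 := by
  have hBB : (Bᴴ * B).PosDef := posDef_of_det_gram_ne_zero (by simp [hB])
  rw [← det_conjTranspose_mul_mul_ne_zero_iff hBB (X := X), conjTranspose_mul]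
  simp only [Matrix.mul_assoc]

theorem det_gram_mul_right_ne_zero {T : Matrix (Fin r) (Fin r) ℂ} (hT : T.det ≠ 0)
    {X : Matrix (Fin m) (Fin r) ℂ} (hX : (Xᴴ * X).det ≠ 0) :
    ((X * T)ᴴ * (X * T)).det ≠ 0 := by
  have : (X * T)ᴴ * (X * T) = Tᴴ * (Xᴴ * X) * T := by
    simp [conjTranspose_mul, Matrix.mul_assoc]
  rw [this, det_mul, det_mul, det_conjTranspose]
  exact mul_ne_zero (mul_ne_zero (star_ne_zero.mpr hT) hX) hT

theorem gram_nonneg (X : Matrix (Fin m) (Fin r) ℂ) : 0 ≤ Xᴴ * X :=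
  (posSemidef_conjTranspose_mul_self X).nonneg

theorem sqrt_mul_sqrt_gram (X : Matrix (Fin m) (Fin r) ℂ) :
    CFC.sqrt (Xᴴ * X) * CFC.sqrt (Xᴴ * X) = Xᴴ * X :=
  CFC.sqrt_mul_sqrt_self _ (gram_nonneg X)

theorem conjTranspose_sqrt (S : Matrix (Fin r) (Fin r) ℂ) : (CFC.sqrt S)ᴴ = CFC.sqrt S :=
  (CFC.sqrt_nonneg S).posSemidef.isHermitian

theorem det_sqrt_gram_ne_zero {X : Matrix (Fin m) (Fin r) ℂ} (hX : (Xᴴ * X).det ≠ 0) :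
    (CFC.sqrt (Xᴴ * X)).det ≠ 0 := by
  intro h
  rw [← sqrt_mul_sqrt_gram, det_mul, h, zero_mul] at hX
  exact hX rfl

theorem orientation_mul_sqrt {X : Matrix (Fin m) (Fin r) ℂ} (hX : (Xᴴ * X).det ≠ 0) :
    orientation X * CFC.sqrt (Xᴴ * X) = X := by
  rw [orientation, Matrix.mul_assoc,
    nonsing_inv_mul _ (isUnit_iff_ne_zero.mpr (det_sqrt_gram_ne_zero hX)), Matrix.mul_one]

theorem orientation_mem_stiefel {X : Matrix (Fin m) (Fin r) ℂ} (hX : (Xᴴ * X).det ≠ 0) :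
    orientation X ∈ stiefel m r := by
  have hu := isUnit_iff_ne_zero.mpr (det_sqrt_gram_ne_zero hX)
  change (orientation X)ᴴ * orientation X = 1
  rw [orientation, conjTranspose_mul, conjTranspose_nonsing_inv, conjTranspose_sqrt,
    Matrix.mul_assoc, ← Matrix.mul_assoc Xᴴ]
  nth_rw 2 [← sqrt_mul_sqrt_gram X]
  rw [Matrix.mul_assoc, mul_nonsing_inv _ hu, Matrix.mul_one, nonsing_inv_mul _ hu]

/-- A singular root has default inverse `0`, which makes the orientation `0`; this is not a frame
unless `r = 0`, where the empty determinant is `1` anyway. Full rank can thus be read off from the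
law of the orientation. -/
theorem det_gram_ne_zero_of_orientation_mem_stiefel {X : Matrix (Fin m) (Fin r) ℂ}
    (hX : orientation X ∈ stiefel m r) : (Xᴴ * X).det ≠ 0 := by
  intro h
  have hs : (CFC.sqrt (Xᴴ * X)).det = 0 := by
    rw [← sqrt_mul_sqrt_gram, det_mul] at h
    exact mul_self_eq_zero.mp h
  have hX : (orientation X)ᴴ * orientation X = 1 := hX
  rw [orientation, nonsing_inv_apply_not_isUnit _ (by simp [hs]), Matrix.mul_zero,
    Matrix.mul_zero] at hX
  cases r with
  | zero => simp at h
  | succ n => simpa using congrFun (congrFun hX 0) 0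

theorem orientation_mul_left {U : Matrix (Fin m) (Fin m) ℂ} (hU : U ∈ unitaryGroup (Fin m) ℂ)
    (X : Matrix (Fin m) (Fin r) ℂ) : orientation (U * X) = U * orientation X := by
  have hU' : Uᴴ * U = 1 := mem_unitaryGroup_iff'.mp hU
  have : (U * X)ᴴ * (U * X) = Xᴴ * X := by
    rw [conjTranspose_mul, Matrix.mul_assoc, ← Matrix.mul_assoc Uᴴ, hU', Matrix.one_mul]
  rw [orientation, orientation, this, Matrix.mul_assoc]

theorem orientation_mul_right {Q : Matrix (Fin r) (Fin r) ℂ} (hQ : Q ∈ unitaryGroup (Fin r) ℂ)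
    (X : Matrix (Fin m) (Fin r) ℂ) : orientation (X * Q) = orientation X * Q := by
  have h1 : Qᴴ * Q = 1 := mem_unitaryGroup_iff'.mp hQ
  have h2 : Q * Qᴴ = 1 := mem_unitaryGroup_iff.mp hQ
  -- Conjugating the root by `Q` gives a positive semidefinite root of the conjugated Gram matrix,
  -- and such a root is unique.
  have hs : CFC.sqrt ((X * Q)ᴴ * (X * Q)) = Qᴴ * CFC.sqrt (Xᴴ * X) * Q := by
    refine CFC.sqrt_unique ?_ ?_
    · calc Qᴴ * CFC.sqrt (Xᴴ * X) * Q * (Qᴴ * CFC.sqrt (Xᴴ * X) * Q)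
          = Qᴴ * CFC.sqrt (Xᴴ * X) * (Q * Qᴴ) * CFC.sqrt (Xᴴ * X) * Q := by
            simp only [Matrix.mul_assoc]
        _ = Qᴴ * (CFC.sqrt (Xᴴ * X) * CFC.sqrt (Xᴴ * X)) * Q := by
            rw [h2]; simp only [Matrix.mul_assoc, Matrix.one_mul]
        _ = _ := by
            rw [sqrt_mul_sqrt_gram, conjTranspose_mul]; simp only [Matrix.mul_assoc]
    · exact ((CFC.sqrt_nonneg (Xᴴ * X)).posSemidef.conjTranspose_mul_mul_same Q).nonneg
  have hQi : Q⁻¹ = Qᴴ := inv_eq_left_inv h1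
  have hQi' : (Qᴴ)⁻¹ = Q := inv_eq_left_inv h2
  rw [orientation, orientation, hs, Matrix.mul_inv_rev, Matrix.mul_inv_rev, hQi, hQi']
  calc X * Q * (Qᴴ * ((CFC.sqrt (Xᴴ * X))⁻¹ * Q))
      = X * (Q * Qᴴ) * (CFC.sqrt (Xᴴ * X))⁻¹ * Q := by simp only [Matrix.mul_assoc]
    _ = _ := by rw [h2, Matrix.mul_one]

/-- Multiplying on the right by a non-singular matrix changes the orientation by a unitary. -/
theorem exists_orientation_mul_eq {T : Matrix (Fin r) (Fin r) ℂ} (hT : T.det ≠ 0)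
    {X : Matrix (Fin m) (Fin r) ℂ} (hX : (Xᴴ * X).det ≠ 0) :
    ∃ W ∈ unitaryGroup (Fin r) ℂ, orientation (X * T) = orientation X * W := by
  -- This `W` is forced by `X = H_X (X̄'X)^{1/2}`. It is unitary because both orientations have
  -- orthonormal columns.
  set W := CFC.sqrt (Xᴴ * X) * T * (CFC.sqrt ((X * T)ᴴ * (X * T)))⁻¹ with hW
  have h : orientation (X * T) = orientation X * W := by
    rw [hW, Matrix.mul_assoc, ← Matrix.mul_assoc (orientation X), orientation_mul_sqrt hX,
      ← Matrix.mul_assoc]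
    rfl
  refine ⟨W, mem_unitaryGroup_iff'.mpr ?_, h⟩
  have h1 : (orientation (X * T))ᴴ * orientation (X * T) = 1 :=
    orientation_mem_stiefel (det_gram_mul_right_ne_zero hT hX)
  have h0 : (orientation X)ᴴ * orientation X = 1 := orientation_mem_stiefel hX
  rw [h, conjTranspose_mul, Matrix.mul_assoc, ← Matrix.mul_assoc _ (orientation X), h0,
    Matrix.one_mul] at h1
  exact h1

/-! ### Measurability of the orientation. -/

/-- Squaring is continuous and injective on the closed cone of positive semidefinite matrices, hence
a measurable embedding by the Lusin–Souslin theorem. Preimages under the root are images under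
squaring, so they are measurable. -/
theorem measurable_sqrt_gram :
    Measurable fun X : Matrix (Fin m) (Fin r) ℂ => CFC.sqrt (Xᴴ * X) := by
  have : StandardBorelSpace (Matrix (Fin r) (Fin r) ℂ) :=
    inferInstanceAs (StandardBorelSpace (Fin r → Fin r → ℂ))
  let s : Set (Matrix (Fin r) (Fin r) ℂ) := {S | 0 ≤ S}
  have hsm : MeasurableSet s := by
    have : s = {S | Sᴴ = S} ∩ ⋂ x : Fin r → ℂ, {S | 0 ≤ star x ⬝ᵥ S *ᵥ x} := by
      ext S
      simp [s, nonneg_iff_posSemidef, posSemidef_iff_dotProduct_mulVec, IsHermitian]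
    rw [this]
    refine IsClosed.measurableSet ?_
    refine (isClosed_eq (by fun_prop) continuous_id).inter (isClosed_iInter fun x => ?_)
    exact isClosed_le continuous_const (by fun_prop)
  have : StandardBorelSpace s := hsm.standardBorel
  have hemb : MeasurableEmbedding fun S : s => (S : Matrix (Fin r) (Fin r) ℂ) * S :=
    Measurable.measurableEmbedding
      (Continuous.measurable (by fun_prop))
      fun S T h => Subtype.ext <| by
        rw [← CFC.sqrt_mul_self S.1 S.2, ← CFC.sqrt_mul_self T.1 T.2]
        exact congrArg CFC.sqrt h
  intro t ht
  have hpre : (fun X : Matrix (Fin m) (Fin r) ℂ => CFC.sqrt (Xᴴ * X)) ⁻¹' t =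
      (fun X => Xᴴ * X) ⁻¹' ((fun S : s => (S : Matrix (Fin r) (Fin r) ℂ) * S) ''
        (Subtype.val ⁻¹' t)) := by
    ext X
    constructor
    · intro h
      exact ⟨⟨_, CFC.sqrt_nonneg (Xᴴ * X)⟩, h, sqrt_mul_sqrt_gram X⟩
    · rintro ⟨S, hS, hSX⟩
      have hSX : S.1 * S.1 = Xᴴ * X := hSX
      change CFC.sqrt (Xᴴ * X) ∈ t
      rw [← hSX, CFC.sqrt_mul_self S.1 S.2]
      exact hS
  rw [hpre]
  exact (Continuous.measurable (by fun_prop)) (hemb.measurableSet_image.mpr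
    (measurable_subtype_coe ht))

theorem measurable_matrix_inv :
    Measurable fun S : Matrix (Fin r) (Fin r) ℂ => S⁻¹ := by
  have h : (fun S : Matrix (Fin r) (Fin r) ℂ => S⁻¹) = fun S => (S.det)⁻¹ • S.adjugate := by
    ext S
    rw [Matrix.inv_def, Ring.inverse_eq_inv]
  rw [h]
  have hd : Measurable fun S : Matrix (Fin r) (Fin r) ℂ => S.det :=
    Continuous.measurable (by fun_prop)
  have ha : Measurable fun S : Matrix (Fin r) (Fin r) ℂ => S.adjugate :=
    Continuous.measurable (by fun_prop)
  refine measurable_pi_lambda _ fun i => measurable_pi_lambda _ fun j => ?_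
  exact hd.inv.mul ((measurable_pi_apply j).comp ((measurable_pi_apply i).comp ha))

theorem measurable_matrix_mul {α : Type*} [MeasurableSpace α] {a b c : ℕ}
    {f : α → Matrix (Fin a) (Fin b) ℂ} {g : α → Matrix (Fin b) (Fin c) ℂ}
    (hf : Measurable f) (hg : Measurable g) : Measurable fun x => f x * g x := by
  have hentry {a b : ℕ} (i : Fin a) (j : Fin b) :
      Measurable fun X : Matrix (Fin a) (Fin b) ℂ => X i j :=
    Continuous.measurable (by fun_prop)
  refine measurable_pi_lambda _ fun i => measurable_pi_lambda _ fun j => ?_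
  simp only [Matrix.mul_apply]
  exact Finset.measurable_sum _ fun k _ => ((hentry i k).comp hf).mul ((hentry k j).comp hg)

theorem measurable_orientation :
    Measurable (orientation : Matrix (Fin m) (Fin r) ℂ → Matrix (Fin m) (Fin r) ℂ) :=
  measurable_matrix_mul measurable_id (measurable_matrix_inv.comp measurable_sqrt_gram)

/-! ### Haar measure on the general linear group. -/

/-- The density `|det T|^{-2r}` of Haar measure on `GL(r, ℂ)` with respect to Lebesgue measure. -/
noncomputable def glDensity (T : Matrix (Fin r) (Fin r) ℂ) : ℝ≥0∞ :=
  ENNReal.ofReal (‖T.det‖ ^ (2 * r))⁻¹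

theorem measurable_glDensity : Measurable (glDensity (r := r)) := by
  have hd : Measurable fun S : Matrix (Fin r) (Fin r) ℂ => S.det :=
    Continuous.measurable (by fun_prop)
  exact ((hd.norm.pow_const _).inv).ennreal_ofReal

/-- For `r > 0` the convention `0⁻¹ = 0` makes the density vanish at singular matrices; for `r = 0`
there are none. -/
theorem det_ne_zero_of_glDensity_ne_zero {T : Matrix (Fin r) (Fin r) ℂ} (hT : glDensity T ≠ 0) :
    T.det ≠ 0 := by
  rintro h
  rcases r.eq_zero_or_pos with rfl | hr
  · simp at h
  · exact hT (by simp [glDensity, h, hr.ne'])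

theorem ofReal_mul_ofReal_inv {x : ℝ} (hx : 0 < x) :
    ENNReal.ofReal x * ENNReal.ofReal x⁻¹ = 1 := by
  rw [← ENNReal.ofReal_mul hx.le, mul_inv_cancel₀ hx.ne', ENNReal.ofReal_one]

theorem glDensity_eq_mul {S T U : Matrix (Fin r) (Fin r) ℂ} (hS : S.det ≠ 0)
    (hU : U.det = S.det * T.det) :
    glDensity T = ENNReal.ofReal (‖S.det‖ ^ (2 * r)) * glDensity U := by
  have : 0 < ‖S.det‖ ^ (2 * r) := by positivity
  rw [glDensity, glDensity, hU, norm_mul, mul_pow, mul_inv, ENNReal.ofReal_mul (by positivity),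
    ← mul_assoc, ofReal_mul_ofReal_inv this, one_mul]

/-- The Jacobian of `T ↦ T S` on square matrices is `|det S|^{2r}`, exactly the factor by which the
density changes. Left multiplication has the same Jacobian, so the measure is invariant on both
sides. -/
theorem lintegral_mul_right_glDensity {S : Matrix (Fin r) (Fin r) ℂ} (hS : S.det ≠ 0)
    {g : Matrix (Fin r) (Fin r) ℂ → ℝ≥0∞} (hg : Measurable g) :
    ∫⁻ T, g (T * S) * glDensity T ∂lebesgue r r = ∫⁻ T, g T * glDensity T ∂lebesgue r r := by
  have hpos : 0 < ‖S.det‖ ^ (2 * r) := by positivity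
  have hk (T) : g (T * S) * glDensity T =
      ENNReal.ofReal (‖S.det‖ ^ (2 * r)) * (g (T * S) * glDensity (T * S)) := by
    rw [glDensity_eq_mul hS (U := T * S) (by rw [det_mul, mul_comm])]
    ring
  have hm : Measurable fun T => g T * glDensity T := hg.mul measurable_glDensity
  simp_rw [hk]
  rw [lintegral_const_mul' _ _ ENNReal.ofReal_ne_top, lintegral_lebesgue_mul_right hS hm,
    ← mul_assoc, ofReal_mul_ofReal_inv hpos, one_mul]

theorem lintegral_mul_left_glDensity {S : Matrix (Fin r) (Fin r) ℂ} (hS : S.det ≠ 0)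
    {g : Matrix (Fin r) (Fin r) ℂ → ℝ≥0∞} (hg : Measurable g) :
    ∫⁻ T, g (S * T) * glDensity T ∂lebesgue r r = ∫⁻ T, g T * glDensity T ∂lebesgue r r := by
  have hpos : 0 < ‖S.det‖ ^ (2 * r) := by positivity
  have hk (T) : g (S * T) * glDensity T =
      ENNReal.ofReal (‖S.det‖ ^ (2 * r)) * (g (S * T) * glDensity (S * T)) := by
    rw [glDensity_eq_mul hS (U := S * T) (det_mul _ _)]
    ring
  have hm : Measurable fun T => g T * glDensity T := hg.mul measurable_glDensity
  simp_rw [hk]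
  rw [lintegral_const_mul' _ _ ENNReal.ofReal_ne_top, lintegral_lebesgue_mul_left hS hm,
    ← mul_assoc, ofReal_mul_ofReal_inv hpos, one_mul]

/-! ### A cut-off in the Gram matrix, with finite and positive mass. -/

/-- A bounded open window of square matrices, containing the identity and staying away from the
singular ones. -/
def window (r : ℕ) : Set (Matrix (Fin r) (Fin r) ℂ) :=
  {S | S.trace.re < r + 1 ∧ 1 / 2 < S.det.re}

theorem isOpen_window (r : ℕ) : IsOpen (window r) :=
  (isOpen_lt (f := fun S : Matrix (Fin r) (Fin r) ℂ => S.trace.re) (by fun_prop)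
    continuous_const).inter (isOpen_lt (g := fun S : Matrix (Fin r) (Fin r) ℂ => S.det.re)
      continuous_const (by fun_prop))

/-- The indicator function of `window r`. -/
noncomputable def windowIndicator (S : Matrix (Fin r) (Fin r) ℂ) : ℝ≥0∞ :=
  (window r).indicator 1 S

theorem measurable_windowIndicator : Measurable (windowIndicator (r := r)) :=
  measurable_one.indicator (isOpen_window r).measurableSet

theorem det_ne_zero_of_windowIndicator_ne_zero {S : Matrix (Fin r) (Fin r) ℂ}
    (hS : windowIndicator S ≠ 0) : S.det ≠ 0 := by
  have h : S ∈ window r := Set.mem_of_indicator_ne_zero hS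
  intro h0
  have := h.2
  rw [h0] at this
  norm_num at this

theorem measurable_gram : Measurable fun X : Matrix (Fin m) (Fin r) ℂ => Xᴴ * X :=
  Continuous.measurable (by fun_prop)

theorem one_mem_window (r : ℕ) : (1 : Matrix (Fin r) (Fin r) ℂ) ∈ window r := by
  constructor
  · simp
  · simp; norm_num

theorem lebesgue_gram_window_pos (h : r ≤ m) :
    0 < lebesgue m r {X | Xᴴ * X ∈ window r} := by
  refine IsOpen.measure_pos _ ((isOpen_window r).preimage (by fun_prop))
    ⟨firstColumns h 1, ?_⟩
  have : (firstColumns h 1)ᴴ * firstColumns h 1 = 1 := firstColumns_mem_stiefel h 1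
  change (firstColumns h 1)ᴴ * firstColumns h 1 ∈ window r
  rw [this]
  exact one_mem_window r

/-- The trace of the Gram matrix is the sum of the squared moduli of the entries, so the trace bound
confines `X` to a compact polydisc. The radius `r + 1` suffices since `r + 1 ≤ (r + 1)²`. -/
theorem lebesgue_gram_window_lt_top :
    lebesgue m r {X | Xᴴ * X ∈ window r} < ∞ := by
  have hK : IsCompact (Set.univ.pi fun _ => Set.univ.pi fun _ =>
      Metric.closedBall (0 : ℂ) (r + 1) : Set (Fin m → Fin r → ℂ)) :=
    isCompact_univ_pi fun _ => isCompact_univ_pi fun _ => isCompact_closedBall _ _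
  have hK' : IsCompact (X := Matrix (Fin m) (Fin r) ℂ) (Set.univ.pi fun _ => Set.univ.pi fun _ =>
      Metric.closedBall (0 : ℂ) (r + 1) : Set (Fin m → Fin r → ℂ)) := hK
  refine (measure_mono fun X hX => ?_).trans_lt hK'.measure_lt_top
  intro i _ j _
  have ht : (Xᴴ * X).trace.re = ∑ b, ∑ a, ‖X a b‖ ^ 2 := by
    simp only [trace, diag_apply, Matrix.mul_apply, conjTranspose_apply, Complex.re_sum]
    refine Finset.sum_congr rfl fun b _ => Finset.sum_congr rfl fun a _ => ?_
    rw [← Complex.normSq_eq_norm_sq]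
    simp [Complex.normSq_apply]
  have h1 : ‖X i j‖ ^ 2 ≤ ∑ b, ∑ a, ‖X a b‖ ^ 2 :=
    (Finset.single_le_sum (f := fun a => ‖X a j‖ ^ 2) (fun _ _ => by positivity)
      (Finset.mem_univ i)).trans
    (Finset.single_le_sum (f := fun b => ∑ a, ‖X a b‖ ^ 2) (fun _ _ => by positivity)
      (Finset.mem_univ j))
  have h2 : (Xᴴ * X).trace.re < r + 1 := hX.1
  have hr : (0 : ℝ) ≤ r := r.cast_nonneg
  rw [mem_closedBall_zero_iff]
  nlinarith [norm_nonneg (X i j)]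

theorem lintegral_windowIndicator_gram :
    ∫⁻ X, windowIndicator (Xᴴ * X) ∂lebesgue m r = lebesgue m r {X | Xᴴ * X ∈ window r} := by
  exact lintegral_indicator_one (measurable_gram (isOpen_window r).measurableSet)

/-- The mass of the window with respect to Haar measure on `GL(r, ℂ)`. -/
noncomputable def glMass (r : ℕ) : ℝ≥0∞ :=
  ∫⁻ T, windowIndicator (Tᴴ * T) * glDensity T ∂lebesgue r r

/-- On the window `|det T|² > 1/2`, so the Haar density is at most `2^r` there. -/
theorem glMass_ne_top : glMass r ≠ ∞ := by
  have hle (T : Matrix (Fin r) (Fin r) ℂ) : windowIndicator (Tᴴ * T) * glDensity T ≤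
      windowIndicator (Tᴴ * T) * ENNReal.ofReal (2 ^ r) := by
    by_cases hT : Tᴴ * T ∈ window r
    · have h : 1 / 2 < ‖T.det‖ ^ 2 := by
        have := hT.2
        rwa [det_mul, det_conjTranspose, Complex.star_def, ← Complex.normSq_eq_conj_mul_self,
          Complex.ofReal_re, Complex.normSq_eq_norm_sq] at this
      gcongr
      refine ENNReal.ofReal_le_ofReal ?_
      rw [pow_mul, ← inv_pow]
      gcongr
      rw [inv_le_comm₀ (by linarith) (by norm_num)]
      linarith
    · simp [windowIndicator, hT]
  refine ((lintegral_mono hle).trans_lt ?_).ne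
  rw [lintegral_mul_const' _ _ ENNReal.ofReal_ne_top, lintegral_windowIndicator_gram]
  exact ENNReal.mul_lt_top lebesgue_gram_window_lt_top ENNReal.ofReal_lt_top

theorem glMass_ne_zero : glMass r ≠ 0 := by
  intro h
  have h := (lintegral_eq_zero_iff
    ((measurable_windowIndicator.comp measurable_gram).mul measurable_glDensity)).mp h
  have hpos := lebesgue_gram_window_pos (le_refl r)
  refine hpos.ne' (measure_mono_null
    (t := {T : Matrix (Fin r) (Fin r) ℂ | ¬windowIndicator (Tᴴ * T) * glDensity T = 0})
    (fun T hT hz => ?_) (ae_iff.mp h))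
  have hd : T.det ≠ 0 := by
    intro h0
    have := hT.2
    rw [det_mul, h0] at this
    norm_num at this
  have hp : 0 < (‖T.det‖ ^ (2 * r))⁻¹ := by positivity
  have hT' : Tᴴ * T ∈ window r := hT
  have hz : windowIndicator (Tᴴ * T) * glDensity T = 0 := hz
  rw [windowIndicator, Set.indicator_of_mem hT', Pi.one_apply, one_mul, glDensity,
    ENNReal.ofReal_eq_zero] at hz
  linarith

theorem exists_eq_conjTranspose_mul_self {G : Matrix (Fin r) (Fin r) ℂ} (hG : G.PosDef) :
    ∃ S : Matrix (Fin r) (Fin r) ℂ, S.det ≠ 0 ∧ G = Sᴴ * S := by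
  have h := CFC.sqrt_mul_sqrt_self G hG.posSemidef.nonneg
  refine ⟨CFC.sqrt G, fun h0 => ?_, by rw [conjTranspose_sqrt, h]⟩
  have hd : G.det ≠ 0 := (hG.isUnit.map detMonoidHom).ne_zero
  rw [← h, det_mul, h0, zero_mul] at hd
  exact hd rfl

/-- With `X̄'X = S̄'S` for a non-singular square `S`, the Gram matrices of `X T` and `S T` agree,
and left invariance removes `S`. The value is therefore the same for all `X` of full rank. -/
theorem lintegral_gram_mul_glDensity {X : Matrix (Fin m) (Fin r) ℂ} (hX : (Xᴴ * X).det ≠ 0) :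
    ∫⁻ T, windowIndicator ((X * T)ᴴ * (X * T)) * glDensity T ∂lebesgue r r = glMass r := by
  obtain ⟨S, hS, hG⟩ := exists_eq_conjTranspose_mul_self (posDef_of_det_gram_ne_zero hX)
  have h (T : Matrix (Fin r) (Fin r) ℂ) : (X * T)ᴴ * (X * T) = (S * T)ᴴ * (S * T) := by
    rw [conjTranspose_mul, Matrix.mul_assoc, ← Matrix.mul_assoc Xᴴ, hG, conjTranspose_mul]
    simp only [Matrix.mul_assoc]
  simp_rw [h]
  exact lintegral_mul_left_glDensity hS (measurable_windowIndicator.comp measurable_gram)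

/-- With `X̄'AX = S̄'S`, the argument of `w` is the Gram matrix of `S T⁻¹ = (T S⁻¹)⁻¹`, and right
invariance removes `S`. Neither `A` nor `X` survives. -/
theorem lintegral_sandwich_inv_mul_glDensity {A : Matrix (Fin m) (Fin m) ℂ} (hA : A.PosDef)
    {X : Matrix (Fin m) (Fin r) ℂ} (hX : (Xᴴ * X).det ≠ 0)
    {w : Matrix (Fin r) (Fin r) ℂ → ℝ≥0∞} (hw : Measurable w) :
    ∫⁻ T, w ((X * T⁻¹)ᴴ * A * (X * T⁻¹)) * glDensity T ∂lebesgue r r =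
      ∫⁻ T, w ((T⁻¹)ᴴ * T⁻¹) * glDensity T ∂lebesgue r r := by
  obtain ⟨S, hS, hG⟩ := exists_eq_conjTranspose_mul_self
    (hA.conjTranspose_mul_mul_same (mulVec_injective_iff_det_gram_ne_zero.mpr hX))
  have hSu : IsUnit S.det := isUnit_iff_ne_zero.mpr hS
  have h (T : Matrix (Fin r) (Fin r) ℂ) : (X * T⁻¹)ᴴ * A * (X * T⁻¹) =
      ((T * S⁻¹)⁻¹)ᴴ * (T * S⁻¹)⁻¹ := by
    rw [Matrix.mul_inv_rev, nonsing_inv_nonsing_inv _ hSu, conjTranspose_mul, conjTranspose_mul]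
    calc _ = (T⁻¹)ᴴ * (Xᴴ * A * X) * T⁻¹ := by simp only [Matrix.mul_assoc]
      _ = _ := by rw [hG]; simp only [Matrix.mul_assoc]
  simp_rw [h]
  refine lintegral_mul_right_glDensity (S := S⁻¹) ?_
    (hw.comp (measurable_gram.comp measurable_matrix_inv))
  rw [det_nonsing_inv, Ring.inverse_eq_inv]
  exact inv_ne_zero hS

/-! ### Homogeneous functions and independence of the weight. -/

/-- Functions of full-rank `m × r` matrices that scale like `|det(X̄' X)|^{-m}` under the right
action of `GL(r, ℂ)`. -/
def IsHomogeneous (ψ : Matrix (Fin m) (Fin r) ℂ → ℝ≥0∞) : Prop :=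
  ∀ (X : Matrix (Fin m) (Fin r) ℂ) (T : Matrix (Fin r) (Fin r) ℂ), (Xᴴ * X).det ≠ 0 → T.det ≠ 0 →
    ψ (X * T) = ENNReal.ofReal (‖T.det‖ ^ (2 * m))⁻¹ * ψ X

/-- The integral of a homogeneous function against a weight depending only on `X̄' A X` does not
depend on the positive definite matrix `A`. -/
theorem glMass_mul_lintegral_sandwich {A : Matrix (Fin m) (Fin m) ℂ} (hA : A.PosDef)
    {ψ : Matrix (Fin m) (Fin r) ℂ → ℝ≥0∞} (hψ : Measurable ψ) (hom : IsHomogeneous ψ)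
    {w : Matrix (Fin r) (Fin r) ℂ → ℝ≥0∞} (hw : Measurable w) (hw0 : ∀ S, w S ≠ 0 → S.det ≠ 0) :
    glMass r * ∫⁻ X, ψ X * w (Xᴴ * A * X) ∂lebesgue m r =
      (∫⁻ T, w ((T⁻¹)ᴴ * T⁻¹) * glDensity T ∂lebesgue r r) *
        ∫⁻ X, ψ X * windowIndicator (Xᴴ * X) ∂lebesgue m r := by
  have hsand : Measurable fun X : Matrix (Fin m) (Fin r) ℂ => Xᴴ * A * X :=
    Continuous.measurable (by fun_prop)
  have hwX : Measurable fun X : Matrix (Fin m) (Fin r) ℂ => w (Xᴴ * A * X) := hw.comp hsand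
  have hbX : Measurable fun X : Matrix (Fin m) (Fin r) ℂ => windowIndicator (Xᴴ * X) :=
    measurable_windowIndicator.comp measurable_gram
  have hmulm : Measurable fun p : Matrix (Fin m) (Fin r) ℂ × Matrix (Fin r) (Fin r) ℂ =>
      p.1 * p.2 := measurable_matrix_mul measurable_fst measurable_snd
  have hmulinv : Measurable fun p : Matrix (Fin m) (Fin r) ℂ × Matrix (Fin r) (Fin r) ℂ =>
      p.1 * p.2⁻¹ :=
    measurable_matrix_mul measurable_fst (measurable_matrix_inv.comp measurable_snd)
  -- Substitute `X T⁻¹` for `X`: the Jacobian `|det T|^{-2m}` cancels the factor `|det T|^{2m}`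
  -- produced by `ψ`. This is where the degree of homogeneity matters.
  have hinner (T : Matrix (Fin r) (Fin r) ℂ) :
      ∫⁻ X, ψ X * w (Xᴴ * A * X) *
        (windowIndicator ((X * T)ᴴ * (X * T)) * glDensity T) ∂lebesgue m r =
      ∫⁻ X, ψ X * windowIndicator (Xᴴ * X) *
        (w ((X * T⁻¹)ᴴ * A * (X * T⁻¹)) * glDensity T) ∂lebesgue m r := by
    by_cases hk : glDensity T = 0
    · simp [hk]
    have hT := det_ne_zero_of_glDensity_ne_zero hk
    have hTu : IsUnit T.det := isUnit_iff_ne_zero.mpr hT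
    have hTi : (T⁻¹).det = T.det⁻¹ := by rw [det_nonsing_inv, Ring.inverse_eq_inv]
    have hpos : 0 < ‖T.det‖ ^ (2 * m) := by positivity
    let G (Y : Matrix (Fin m) (Fin r) ℂ) : ℝ≥0∞ :=
      ψ (Y * T⁻¹) * w ((Y * T⁻¹)ᴴ * A * (Y * T⁻¹)) * (windowIndicator (Yᴴ * Y) * glDensity T)
    have hTm : Measurable fun Y : Matrix (Fin m) (Fin r) ℂ => Y * T⁻¹ :=
      Continuous.measurable (by fun_prop)
    have hG : Measurable G :=
      ((hψ.comp hTm).mul (hwX.comp hTm)).mul (hbX.mul_const _)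
    have hGY (Y) : G Y = ENNReal.ofReal (‖T.det‖ ^ (2 * m)) * (ψ Y * windowIndicator (Yᴴ * Y) *
        (w ((Y * T⁻¹)ᴴ * A * (Y * T⁻¹)) * glDensity T)) := by
      by_cases hY : windowIndicator (Yᴴ * Y) = 0
      · simp [G, hY]
      simp only [G]
      rw [hom Y T⁻¹ (det_ne_zero_of_windowIndicator_ne_zero hY) (by rw [hTi]; exact inv_ne_zero hT),
        hTi, norm_inv, inv_pow, inv_inv]
      ring
    have hGX (X) : ψ X * w (Xᴴ * A * X) *
        (windowIndicator ((X * T)ᴴ * (X * T)) * glDensity T) = G (X * T) := by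
      simp only [G]
      rw [Matrix.mul_assoc X T, mul_nonsing_inv _ hTu, Matrix.mul_one]
    simp_rw [hGX]
    rw [lintegral_lebesgue_mul_right hT hG]
    simp_rw [hGY]
    rw [lintegral_const_mul' _ _ ENNReal.ofReal_ne_top, ← mul_assoc, mul_comm (ENNReal.ofReal _),
      ofReal_mul_ofReal_inv hpos, one_mul]
  have hL (X : Matrix (Fin m) (Fin r) ℂ) : glMass r * (ψ X * w (Xᴴ * A * X)) =
      ∫⁻ T, ψ X * w (Xᴴ * A * X) *
        (windowIndicator ((X * T)ᴴ * (X * T)) * glDensity T) ∂lebesgue r r := by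
    -- The integral over `T` equals `glMass` only at full rank; off the support of `w` both sides
    -- vanish.
    by_cases hX : w (Xᴴ * A * X) = 0
    · simp [hX]
    have hm : Measurable fun T : Matrix (Fin r) (Fin r) ℂ =>
        windowIndicator ((X * T)ᴴ * (X * T)) * glDensity T :=
      (hbX.comp (Continuous.measurable (by fun_prop))).mul measurable_glDensity
    rw [lintegral_const_mul _ hm, lintegral_gram_mul_glDensity
      ((det_conjTranspose_mul_mul_ne_zero_iff hA).mp (hw0 _ hX)), mul_comm]
  have hR (X : Matrix (Fin m) (Fin r) ℂ) :
      ∫⁻ T, ψ X * windowIndicator (Xᴴ * X) *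
        (w ((X * T⁻¹)ᴴ * A * (X * T⁻¹)) * glDensity T) ∂lebesgue r r =
      (∫⁻ T, w ((T⁻¹)ᴴ * T⁻¹) * glDensity T ∂lebesgue r r) *
        (ψ X * windowIndicator (Xᴴ * X)) := by
    by_cases hX : windowIndicator (Xᴴ * X) = 0
    · simp [hX]
    have hm : Measurable fun T : Matrix (Fin r) (Fin r) ℂ =>
        w ((X * T⁻¹)ᴴ * A * (X * T⁻¹)) * glDensity T :=
      (hwX.comp (measurable_matrix_mul measurable_const measurable_matrix_inv)).mul
        measurable_glDensity
    rw [lintegral_const_mul _ hm, lintegral_sandwich_inv_mul_glDensity hA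
      (det_ne_zero_of_windowIndicator_ne_zero hX) hw, mul_comm]
  have hψw : Measurable fun X => ψ X * w (Xᴴ * A * X) := hψ.mul hwX
  have hψb : Measurable fun X => ψ X * windowIndicator (Xᴴ * X) := hψ.mul hbX
  rw [← lintegral_const_mul _ hψw, ← lintegral_const_mul _ hψb]
  simp_rw [← hR]
  simp_rw [hL]
  rw [lintegral_lintegral_swap]
  · simp_rw [hinner]
    rw [lintegral_lintegral_swap]
    exact (((hψ.comp measurable_snd).mul (hbX.comp measurable_snd)).mul
      ((hwX.comp (hmulinv.comp measurable_swap)).mul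
        (measurable_glDensity.comp measurable_fst))).aemeasurable
  · exact (((hψ.comp measurable_fst).mul (hwX.comp measurable_fst)).mul
      ((hbX.comp hmulm).mul (measurable_glDensity.comp measurable_snd))).aemeasurable

/-! ### From Lebesgue measure to the Stiefel manifold. -/

theorem norm_det_unitary {U : Matrix (Fin m) (Fin m) ℂ} (hU : U ∈ unitaryGroup (Fin m) ℂ) :
    ‖U.det‖ = 1 :=
  CStarRing.norm_of_mem_unitary (det_of_mem_unitary hU)

theorem det_ne_zero_of_mem_unitaryGroup {U : Matrix (Fin m) (Fin m) ℂ}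
    (hU : U ∈ unitaryGroup (Fin m) ℂ) : U.det ≠ 0 :=
  norm_ne_zero_iff.mp (by rw [norm_det_unitary hU]; exact one_ne_zero)

/-- Integrating over orientations of Lebesgue-distributed matrices with Gram matrix in the window
yields the invariant measure of the Stiefel manifold. -/
theorem lintegral_orientation_mul_windowIndicator (h : r ≤ m)
    {g : Matrix (Fin m) (Fin r) ℂ → ℝ≥0∞} (hg : Measurable g) :
    ∫⁻ X, g (orientation X) * windowIndicator (Xᴴ * X) ∂lebesgue m r =
      lebesgue m r {X | Xᴴ * X ∈ window r} * ∫⁻ X, g X ∂stiefelMeasure h := by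
  have hb : Measurable fun X : Matrix (Fin m) (Fin r) ℂ => windowIndicator (Xᴴ * X) :=
    measurable_windowIndicator.comp measurable_gram
  have hgm : Measurable fun X : Matrix (Fin m) (Fin r) ℂ =>
      g (orientation X) * windowIndicator (Xᴴ * X) := (hg.comp measurable_orientation).mul hb
  -- Left multiplication by `U` preserves Lebesgue measure and the Gram matrix, and rotates the
  -- orientation.
  have hUinv (U : unitaryGroup (Fin m) ℂ) :
      ∫⁻ X, g (orientation X) * windowIndicator (Xᴴ * X) ∂lebesgue m r =
      ∫⁻ X, g (U.1 * orientation X) * windowIndicator (Xᴴ * X) ∂lebesgue m r := by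
    have hl := lintegral_lebesgue_mul_left (det_ne_zero_of_mem_unitaryGroup U.2) hgm
    rw [norm_det_unitary U.2, one_pow, inv_one, ENNReal.ofReal_one, one_mul] at hl
    rw [← hl]
    refine lintegral_congr fun X => ?_
    have hU : (U : Matrix (Fin m) (Fin m) ℂ)ᴴ * U = 1 := mem_unitaryGroup_iff'.mp U.2
    rw [orientation_mul_left U.2, conjTranspose_mul, Matrix.mul_assoc, ← Matrix.mul_assoc _ _ X, hU,
      Matrix.one_mul]
  have hval : Measurable fun U : unitaryGroup (Fin m) ℂ => (U : Matrix (Fin m) (Fin m) ℂ) :=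
    measurable_subtype_coe
  have hmul : Measurable fun p : unitaryGroup (Fin m) ℂ × Matrix (Fin m) (Fin r) ℂ =>
      (p.1 : Matrix (Fin m) (Fin m) ℂ) * orientation p.2 :=
    measurable_matrix_mul (hval.comp measurable_fst) (measurable_orientation.comp measurable_snd)
  calc ∫⁻ X, g (orientation X) * windowIndicator (Xᴴ * X) ∂lebesgue m r
      = ∫⁻ _U : unitaryGroup (Fin m) ℂ, ∫⁻ X, g (orientation X) * windowIndicator (Xᴴ * X)
          ∂lebesgue m r ∂unitaryHaar m := by simp
    _ = ∫⁻ U : unitaryGroup (Fin m) ℂ, ∫⁻ X, g (U.1 * orientation X) * windowIndicator (Xᴴ * X)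
          ∂lebesgue m r ∂unitaryHaar m := lintegral_congr hUinv
    _ = ∫⁻ X, ∫⁻ U : unitaryGroup (Fin m) ℂ, g (U.1 * orientation X) * windowIndicator (Xᴴ * X)
          ∂unitaryHaar m ∂lebesgue m r :=
        lintegral_lintegral_swap ((hg.comp hmul).mul (hb.comp measurable_snd)).aemeasurable
    -- For fixed `X`, the rotated orientation is a uniformly distributed frame, so the integral
    -- factorizes.
    _ = ∫⁻ X, windowIndicator (Xᴴ * X) * ∫⁻ X, g X ∂stiefelMeasure h ∂lebesgue m r := by
        refine lintegral_congr fun X => ?_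
        by_cases hX : windowIndicator (Xᴴ * X) = 0
        · simp [hX]
        have hH := orientation_mem_stiefel (det_ne_zero_of_windowIndicator_ne_zero hX)
        have hm : Measurable fun U : unitaryGroup (Fin m) ℂ =>
            g ((U : Matrix (Fin m) (Fin m) ℂ) * orientation X) :=
          hg.comp (measurable_matrix_mul hval measurable_const)
        rw [lintegral_mul_const _ hm, lintegral_unitaryHaar_mul h hH hg, mul_comm]
    _ = _ := by rw [lintegral_mul_const _ hb, lintegral_windowIndicator_gram]

theorem det_sandwich_mul_right_re (A : Matrix (Fin m) (Fin m) ℂ) (X : Matrix (Fin m) (Fin r) ℂ)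
    (T : Matrix (Fin r) (Fin r) ℂ) :
    ((X * T)ᴴ * A * (X * T)).det.re = ‖T.det‖ ^ 2 * (Xᴴ * A * X).det.re := by
  have h : (X * T)ᴴ * A * (X * T) = Tᴴ * (Xᴴ * A * X) * T := by
    simp only [conjTranspose_mul, Matrix.mul_assoc]
  rw [h, det_mul, det_mul, det_conjTranspose, mul_right_comm, Complex.star_def,
    ← Complex.normSq_eq_conj_mul_self, Complex.re_ofReal_mul, Complex.normSq_eq_norm_sq]

/-- Take `T = (X̄'X)^{-1/2}`, for which `|det T|^{-2m}` is `det(X̄'X)^m`. -/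
theorem IsHomogeneous.orientation {ψ : Matrix (Fin m) (Fin r) ℂ → ℝ≥0∞} (hψ : IsHomogeneous ψ)
    {X : Matrix (Fin m) (Fin r) ℂ} (hX : (Xᴴ * X).det ≠ 0) :
    ψ (orientation X) = ψ X * ENNReal.ofReal ((Xᴴ * X).det.re ^ m) := by
  have hS := det_sqrt_gram_ne_zero hX
  have hre : (Xᴴ * X).det.re = ‖(CFC.sqrt (Xᴴ * X)).det‖ ^ 2 := by
    have h := det_sandwich_mul_right_re (1 : Matrix (Fin r) (Fin r) ℂ) 1 (CFC.sqrt (Xᴴ * X))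
    simp only [Matrix.one_mul, conjTranspose_sqrt, sqrt_mul_sqrt_gram,
      conjTranspose_one, det_one, Complex.one_re, mul_one] at h
    exact h
  have hSi : (CFC.sqrt (Xᴴ * X))⁻¹.det = (CFC.sqrt (Xᴴ * X)).det⁻¹ := by
    rw [det_nonsing_inv, Ring.inverse_eq_inv]
  rw [CMACG.orientation, hψ X _ hX (by rw [hSi]; exact inv_ne_zero hS), hSi, norm_inv, inv_pow,
    inv_inv, hre, ← pow_mul, mul_comm]

/-- The window weighted by the `m`-th power of the determinant. -/
noncomputable def windowWeight (m : ℕ) (S : Matrix (Fin r) (Fin r) ℂ) : ℝ≥0∞ :=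
  ENNReal.ofReal (S.det.re ^ m) * windowIndicator S

theorem measurable_windowWeight : Measurable (windowWeight m (r := r)) := by
  have hd : Measurable fun S : Matrix (Fin r) (Fin r) ℂ => S.det.re ^ m :=
    Continuous.measurable (by fun_prop)
  exact hd.ennreal_ofReal.mul measurable_windowIndicator

theorem det_ne_zero_of_windowWeight_ne_zero {S : Matrix (Fin r) (Fin r) ℂ}
    (hS : windowWeight m S ≠ 0) : S.det ≠ 0 :=
  det_ne_zero_of_windowIndicator_ne_zero (right_ne_zero_of_mul hS)

/-- The determinant factor in the weight is what turns `ψ(X)` into `ψ` of the orientation of `X`. -/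
theorem lintegral_homogeneous_mul_windowWeight (h : r ≤ m)
    {ψ : Matrix (Fin m) (Fin r) ℂ → ℝ≥0∞} (hψ : Measurable ψ) (hom : IsHomogeneous ψ) :
    ∫⁻ X, ψ X * windowWeight m (Xᴴ * X) ∂lebesgue m r =
      lebesgue m r {X | Xᴴ * X ∈ window r} * ∫⁻ X, ψ X ∂stiefelMeasure h := by
  rw [← lintegral_orientation_mul_windowIndicator h hψ]
  refine lintegral_congr fun X => ?_
  by_cases hX : windowIndicator (Xᴴ * X) = 0
  · simp [hX, windowWeight]
  rw [hom.orientation (det_ne_zero_of_windowIndicator_ne_zero hX), windowWeight, mul_assoc]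

/-- Unfolding with `A` and with the identity gives the same right-hand side; the constant `glMass`
cancels as it is finite and non-zero. -/
theorem lintegral_homogeneous_mul_windowWeight_sandwich {A : Matrix (Fin m) (Fin m) ℂ}
    (hA : A.PosDef) {ψ : Matrix (Fin m) (Fin r) ℂ → ℝ≥0∞} (hψ : Measurable ψ)
    (hom : IsHomogeneous ψ) :
    ∫⁻ X, ψ X * windowWeight m (Xᴴ * A * X) ∂lebesgue m r =
      ∫⁻ X, ψ X * windowWeight m (Xᴴ * X) ∂lebesgue m r := by
  have hw0 (S : Matrix (Fin r) (Fin r) ℂ) : windowWeight m S ≠ 0 → S.det ≠ 0 :=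
    det_ne_zero_of_windowWeight_ne_zero
  have h1 := glMass_mul_lintegral_sandwich hA hψ hom measurable_windowWeight hw0
  have h2 := glMass_mul_lintegral_sandwich PosDef.one hψ hom measurable_windowWeight hw0
  simp only [Matrix.mul_one] at h2
  exact (ENNReal.mul_right_inj glMass_ne_zero glMass_ne_top).mp (h1.trans h2.symm)

/-- Change of variables on the Stiefel manifold under the action of `GL(m, ℂ)`, for functions of
the degree of homogeneity of a density. -/
theorem lintegral_stiefelMeasure_comp_mul_left (h : r ≤ m) {B : Matrix (Fin m) (Fin m) ℂ}
    (hB : B.det ≠ 0) {ψ : Matrix (Fin m) (Fin r) ℂ → ℝ≥0∞} (hψ : Measurable ψ)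
    (hom : IsHomogeneous ψ) :
    ∫⁻ X, ψ (B * X) ∂stiefelMeasure h =
      ENNReal.ofReal (‖B.det‖ ^ (2 * r))⁻¹ * ∫⁻ X, ψ X ∂stiefelMeasure h := by
  have hBu : IsUnit B.det := isUnit_iff_ne_zero.mpr hB
  have hBi : (B⁻¹).det ≠ 0 := by
    rw [det_nonsing_inv, Ring.inverse_eq_inv]; exact inv_ne_zero hB
  have hψB : Measurable fun X : Matrix (Fin m) (Fin r) ℂ => ψ (B * X) :=
    hψ.comp (measurable_matrix_mul measurable_const measurable_id)
  have homB : IsHomogeneous fun X : Matrix (Fin m) (Fin r) ℂ => ψ (B * X) := fun X T hX hT => by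
    have := hom (B * X) T ((det_gram_mul_left_ne_zero_iff hB).mpr hX) hT
    rwa [Matrix.mul_assoc] at this
  -- This choice makes the sandwich of `B X` equal to `X̄'X`, so the substitution by `B` restores
  -- the standard weight.
  have hA : ((B⁻¹)ᴴ * B⁻¹).PosDef :=
    posDef_of_det_gram_ne_zero (by
      rw [det_mul, det_conjTranspose]; exact mul_ne_zero (star_ne_zero.mpr hBi) hBi)
  have hG : Measurable fun X : Matrix (Fin m) (Fin r) ℂ =>
      ψ X * windowWeight m (Xᴴ * ((B⁻¹)ᴴ * B⁻¹) * X) :=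
    hψ.mul (measurable_windowWeight.comp (Continuous.measurable (by fun_prop)))
  have hl := lintegral_lebesgue_mul_left hB hG
  have hsimp (X : Matrix (Fin m) (Fin r) ℂ) :
      (B * X)ᴴ * ((B⁻¹)ᴴ * B⁻¹) * (B * X) = Xᴴ * X := by
    calc _ = (B⁻¹ * (B * X))ᴴ * (B⁻¹ * (B * X)) := by
          rw [conjTranspose_mul B⁻¹]; simp only [Matrix.mul_assoc]
      _ = _ := by rw [nonsing_inv_mul_cancel_left _ _ hBu]
  simp_rw [hsimp] at hl
  rw [lintegral_homogeneous_mul_windowWeight h hψB homB,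
    lintegral_homogeneous_mul_windowWeight_sandwich hA hψ hom,
    lintegral_homogeneous_mul_windowWeight h hψ hom, mul_left_comm] at hl
  exact (ENNReal.mul_right_inj (lebesgue_gram_window_pos h).ne'
    lebesgue_gram_window_lt_top.ne).mp hl

/-! ### The right action of the unitary group and averaging. -/

theorem mul_mem_stiefel {H : Matrix (Fin m) (Fin r) ℂ} (hH : H ∈ stiefel m r)
    {Q : Matrix (Fin r) (Fin r) ℂ} (hQ : Q ∈ unitaryGroup (Fin r) ℂ) : H * Q ∈ stiefel m r := by
  have hH : Hᴴ * H = 1 := hH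
  change (H * Q)ᴴ * (H * Q) = 1
  rw [conjTranspose_mul, Matrix.mul_assoc, ← Matrix.mul_assoc _ H, hH, Matrix.one_mul]
  exact mem_unitaryGroup_iff'.mp hQ

/-- If `H` is a frame, so is `H Q`, and the `U(m)`-orbit integral does not depend on the frame it
starts from. -/
theorem lintegral_stiefelMeasure_mul_right (h : r ≤ m) {Q : Matrix (Fin r) (Fin r) ℂ}
    (hQ : Q ∈ unitaryGroup (Fin r) ℂ) {g : Matrix (Fin m) (Fin r) ℂ → ℝ≥0∞} (hg : Measurable g) :
    ∫⁻ X, g (X * Q) ∂stiefelMeasure h = ∫⁻ X, g X ∂stiefelMeasure h := by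
  have hH := firstColumns_mem_stiefel h 1
  have hgQ : Measurable fun X : Matrix (Fin m) (Fin r) ℂ => g (X * Q) :=
    hg.comp (measurable_matrix_mul measurable_id measurable_const)
  rw [← lintegral_unitaryHaar_mul h hH hgQ,
    ← lintegral_unitaryHaar_mul h (mul_mem_stiefel hH hQ) hg]
  simp only [Matrix.mul_assoc]

theorem orientation_of_mem_stiefel {H : Matrix (Fin m) (Fin r) ℂ} (hH : H ∈ stiefel m r) :
    orientation H = H := by
  have hH : Hᴴ * H = 1 := hH
  rw [orientation, hH, CFC.sqrt_one, inv_one, Matrix.mul_one]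

/-- The average of a function over the right action of `U(r)`. -/
noncomputable def rightAverage (g : Matrix (Fin m) (Fin r) ℂ → ℝ≥0∞)
    (X : Matrix (Fin m) (Fin r) ℂ) : ℝ≥0∞ :=
  ∫⁻ Q : unitaryGroup (Fin r) ℂ, g (X * Q.1) ∂unitaryHaar r

theorem measurable_mul_unitary :
    Measurable fun p : Matrix (Fin m) (Fin r) ℂ × unitaryGroup (Fin r) ℂ =>
      p.1 * (p.2 : Matrix (Fin r) (Fin r) ℂ) :=
  measurable_matrix_mul measurable_fst (measurable_subtype_coe.comp measurable_snd)

theorem measurable_rightAverage {g : Matrix (Fin m) (Fin r) ℂ → ℝ≥0∞} (hg : Measurable g) :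
    Measurable (rightAverage g) :=
  (hg.comp measurable_mul_unitary).lintegral_prod_right'

theorem rightAverage_mul (g : Matrix (Fin m) (Fin r) ℂ → ℝ≥0∞) (X : Matrix (Fin m) (Fin r) ℂ)
    {W : Matrix (Fin r) (Fin r) ℂ} (hW : W ∈ unitaryGroup (Fin r) ℂ) :
    rightAverage g (X * W) = rightAverage g X := by
  have : (unitaryHaar r).IsMulLeftInvariant := by unfold unitaryHaar; infer_instance
  rw [rightAverage, rightAverage, ← lintegral_mul_left_eq_self (μ := unitaryHaar r)
    (fun Q : unitaryGroup (Fin r) ℂ => g (X * Q.1)) ⟨W, hW⟩]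
  simp only [Matrix.mul_assoc]
  rfl

/-! ### The CMACG density and its transformation rules. -/

/-- The density of the complex matrix angular central Gaussian distribution. -/
noncomputable def density (P : Matrix (Fin m) (Fin m) ℂ) (H : Matrix (Fin m) (Fin r) ℂ) : ℝ≥0∞ :=
  ENNReal.ofReal ((P.det.re ^ r)⁻¹ * ((Hᴴ * P⁻¹ * H).det.re ^ m)⁻¹)

theorem measurable_density (P : Matrix (Fin m) (Fin m) ℂ) :
    Measurable (density P (r := r)) := by
  have h : Measurable fun H : Matrix (Fin m) (Fin r) ℂ => (Hᴴ * P⁻¹ * H).det.re :=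
    Continuous.measurable (by fun_prop)
  exact ((h.pow_const m).inv.const_mul _).ennreal_ofReal

theorem density_mul_right (P : Matrix (Fin m) (Fin m) ℂ) (X : Matrix (Fin m) (Fin r) ℂ)
    (T : Matrix (Fin r) (Fin r) ℂ) :
    density P (X * T) = ENNReal.ofReal (‖T.det‖ ^ (2 * m))⁻¹ * density P X := by
  rw [density, density, det_sandwich_mul_right_re, ← ENNReal.ofReal_mul (by positivity), mul_pow,
    mul_inv, ← pow_mul, mul_left_comm]

theorem density_mul_unitary (P : Matrix (Fin m) (Fin m) ℂ) (X : Matrix (Fin m) (Fin r) ℂ)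
    {Q : Matrix (Fin r) (Fin r) ℂ} (hQ : Q ∈ unitaryGroup (Fin r) ℂ) :
    density P (X * Q) = density P X := by
  simp [density_mul_right, norm_det_unitary hQ]

/-- The quadratic form `X̄'P⁻¹X` is unchanged, so only the normalizing power of `det P` contributes.
-/
theorem density_mul_left {B : Matrix (Fin m) (Fin m) ℂ} (hB : B.det ≠ 0)
    (P : Matrix (Fin m) (Fin m) ℂ) (X : Matrix (Fin m) (Fin r) ℂ) :
    density (B * P * Bᴴ) (B * X) = ENNReal.ofReal (‖B.det‖ ^ (2 * r))⁻¹ * density P X := by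
  have hBu : IsUnit B.det := isUnit_iff_ne_zero.mpr hB
  have h1 : (B * P * Bᴴ).det.re = ‖B.det‖ ^ 2 * P.det.re := by
    rw [det_mul, det_mul, det_conjTranspose, mul_right_comm, Complex.star_def, Complex.mul_conj,
      Complex.re_ofReal_mul, Complex.normSq_eq_norm_sq]
  have h2 : (B * X)ᴴ * (B * P * Bᴴ)⁻¹ * (B * X) = Xᴴ * P⁻¹ * X := by
    have h3 : Bᴴ * (Bᴴ)⁻¹ = 1 := by
      rw [← conjTranspose_nonsing_inv, ← conjTranspose_mul, nonsing_inv_mul _ hBu,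
        conjTranspose_one]
    rw [Matrix.mul_inv_rev, Matrix.mul_inv_rev, conjTranspose_mul]
    calc _ = Xᴴ * (Bᴴ * (Bᴴ)⁻¹) * P⁻¹ * (B⁻¹ * B) * X := by simp only [Matrix.mul_assoc]
      _ = _ := by rw [h3, nonsing_inv_mul _ hBu, Matrix.mul_one, Matrix.mul_one]
  rw [density, density, h1, h2, ← ENNReal.ofReal_mul (by positivity), mul_pow, mul_inv, ← pow_mul,
    mul_assoc]

theorem lintegral_cmacg (h : r ≤ m) (P : Matrix (Fin m) (Fin m) ℂ)
    {g : Matrix (Fin m) (Fin r) ℂ → ℝ≥0∞} (hg : Measurable g) :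
    ∫⁻ H, g H ∂cmacg h P = ∫⁻ H, density P H * g H ∂stiefelMeasure h :=
  lintegral_withDensity_eq_lintegral_mul _ (measurable_density P) hg

/-- Both the invariant measure and the density are right unitarily invariant, so every right
translate of `g` has the same integral. -/
theorem lintegral_cmacg_rightAverage (h : r ≤ m) (P : Matrix (Fin m) (Fin m) ℂ)
    {g : Matrix (Fin m) (Fin r) ℂ → ℝ≥0∞} (hg : Measurable g) :
    ∫⁻ H, rightAverage g H ∂cmacg h P = ∫⁻ H, g H ∂cmacg h P := by
  have hprod : Measurable fun p : Matrix (Fin m) (Fin r) ℂ × unitaryGroup (Fin r) ℂ =>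
      density P p.1 * g (p.1 * p.2.1) :=
    ((measurable_density P).comp measurable_fst).mul (hg.comp measurable_mul_unitary)
  have hdg : Measurable fun X => density P X * g X := (measurable_density P).mul hg
  have hQ (Q : unitaryGroup (Fin r) ℂ) : ∫⁻ H, density P H * g (H * Q.1) ∂stiefelMeasure h =
      ∫⁻ H, density P H * g H ∂stiefelMeasure h := by
    rw [← lintegral_stiefelMeasure_mul_right h Q.2 hdg]
    simp_rw [density_mul_unitary P _ Q.2]
  calc ∫⁻ H, rightAverage g H ∂cmacg h P
      = ∫⁻ H, ∫⁻ Q : unitaryGroup (Fin r) ℂ, density P H * g (H * Q.1) ∂unitaryHaar r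
          ∂stiefelMeasure h := by
        rw [lintegral_cmacg h P (measurable_rightAverage hg)]
        refine lintegral_congr fun H => ?_
        exact (lintegral_const_mul' _ _ ENNReal.ofReal_ne_top).symm
    _ = ∫⁻ Q : unitaryGroup (Fin r) ℂ, ∫⁻ H, density P H * g (H * Q.1) ∂stiefelMeasure h
          ∂unitaryHaar r := lintegral_lintegral_swap hprod.aemeasurable
    _ = _ := by simp_rw [hQ]; simp [lintegral_cmacg h P hg]

theorem ae_mem_stiefel_cmacg (h : r ≤ m) (P : Matrix (Fin m) (Fin m) ℂ) :
    ∀ᵐ H ∂cmacg h P, H ∈ stiefel m r :=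
  (withDensity_absolutelyContinuous _ _).ae_le (stiefelMeasure_compl_stiefel h)

/-- A law with a right-unitarily invariant density integrates a function of the orientation of
`B X` like its right average. -/
theorem lintegral_withDensity_orientation_rightAverage {f : Matrix (Fin m) (Fin r) ℂ → ℝ≥0∞}
    (hf : Measurable f)
    (hinv : ∀ Q ∈ unitaryGroup (Fin r) ℂ, ∀ᵐ X ∂lebesgue m r, f (X * Q) = f X)
    (B : Matrix (Fin m) (Fin m) ℂ) {g : Matrix (Fin m) (Fin r) ℂ → ℝ≥0∞} (hg : Measurable g) :
    ∫⁻ X, g (orientation (B * X)) ∂(lebesgue m r).withDensity f =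
      ∫⁻ X, rightAverage g (orientation (B * X)) ∂(lebesgue m r).withDensity f := by
  have hor : Measurable fun X : Matrix (Fin m) (Fin r) ℂ => orientation (B * X) :=
    measurable_orientation.comp (Continuous.measurable (by fun_prop))
  have hfg : Measurable fun X => f X * g (orientation (B * X)) := hf.mul (hg.comp hor)
  have hgQ : Measurable fun p : Matrix (Fin m) (Fin r) ℂ × unitaryGroup (Fin r) ℂ =>
      g (orientation (B * p.1) * p.2.1) :=
    hg.comp (measurable_matrix_mul (hor.comp measurable_fst)
      (measurable_subtype_coe.comp measurable_snd))
  have hprod : Measurable fun p : Matrix (Fin m) (Fin r) ℂ × unitaryGroup (Fin r) ℂ =>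
      f p.1 * g (orientation (B * p.1) * p.2.1) := (hf.comp measurable_fst).mul hgQ
  -- The exceptional null set in the invariance of `f` may depend on `Q`; this is harmless because
  -- `Q` is fixed before integrating over `X`.
  have hQ (Q : unitaryGroup (Fin r) ℂ) :
      ∫⁻ X, f X * g (orientation (B * X)) ∂lebesgue m r =
      ∫⁻ X, f X * g (orientation (B * X) * Q.1) ∂lebesgue m r := by
    have hl := lintegral_lebesgue_mul_right (det_ne_zero_of_mem_unitaryGroup Q.2) hfg
    rw [norm_det_unitary Q.2, one_pow, inv_one, ENNReal.ofReal_one, one_mul] at hl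
    rw [← hl]
    refine lintegral_congr_ae ?_
    filter_upwards [hinv Q Q.2] with X hX
    rw [hX, ← Matrix.mul_assoc, orientation_mul_right Q.2]
  calc ∫⁻ X, g (orientation (B * X)) ∂(lebesgue m r).withDensity f
      = ∫⁻ _Q : unitaryGroup (Fin r) ℂ, ∫⁻ X, f X * g (orientation (B * X)) ∂lebesgue m r
          ∂unitaryHaar r := by
        rw [lintegral_const, measure_univ, mul_one]
        exact lintegral_withDensity_eq_lintegral_mul _ hf (hg.comp hor)
    _ = ∫⁻ Q : unitaryGroup (Fin r) ℂ, ∫⁻ X, f X * g (orientation (B * X) * Q.1) ∂lebesgue m r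
          ∂unitaryHaar r := lintegral_congr hQ
    _ = ∫⁻ X, ∫⁻ Q : unitaryGroup (Fin r) ℂ, f X * g (orientation (B * X) * Q.1) ∂unitaryHaar r
          ∂lebesgue m r :=
        lintegral_lintegral_swap (hprod.comp measurable_swap).aemeasurable
    _ = ∫⁻ X, f X * rightAverage g (orientation (B * X)) ∂lebesgue m r := by
        refine lintegral_congr fun X => ?_
        have hm : Measurable fun Q : unitaryGroup (Fin r) ℂ => g (orientation (B * X) * Q.1) :=
          hg.comp (measurable_matrix_mul measurable_const measurable_subtype_coe)
        exact lintegral_const_mul _ hm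
    _ = _ := (lintegral_withDensity_eq_lintegral_mul _ hf
        ((measurable_rightAverage hg).comp hor)).symm

theorem rightAverage_orientation_mul (g : Matrix (Fin m) (Fin r) ℂ → ℝ≥0∞)
    {X : Matrix (Fin m) (Fin r) ℂ} (hX : (Xᴴ * X).det ≠ 0) {T : Matrix (Fin r) (Fin r) ℂ}
    (hT : T.det ≠ 0) :
    rightAverage g (orientation (X * T)) = rightAverage g (orientation X) := by
  obtain ⟨W, hW, h⟩ := exists_orientation_mul_eq hT hX
  rw [h, rightAverage_mul g _ hW]

theorem lintegral_cmacg_rightAverage_orientation_mul (h : r ≤ m) {B : Matrix (Fin m) (Fin m) ℂ}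
    (hB : B.det ≠ 0) (P : Matrix (Fin m) (Fin m) ℂ) {g : Matrix (Fin m) (Fin r) ℂ → ℝ≥0∞}
    (hg : Measurable g) :
    ∫⁻ H, rightAverage g (orientation (B * H)) ∂cmacg h P =
      ∫⁻ H, rightAverage g H ∂cmacg h (B * P * Bᴴ) := by
  have hav : Measurable fun X => rightAverage g (orientation X) :=
    (measurable_rightAverage hg).comp measurable_orientation
  have havB : Measurable fun X : Matrix (Fin m) (Fin r) ℂ =>
      rightAverage g (orientation (B * X)) :=
    hav.comp (measurable_matrix_mul measurable_const measurable_id)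
  -- Composing with the orientation extends the average of `g` to a function of degree 0. Averaging
  -- is essential: right multiplication by `T` alters the orientation by a unitary. The density
  -- supplies the degree required by `IsHomogeneous`.
  let ψ (X : Matrix (Fin m) (Fin r) ℂ) : ℝ≥0∞ :=
    density (B * P * Bᴴ) X * rightAverage g (orientation X)
  have hψ : Measurable ψ := (measurable_density _).mul hav
  have hom : IsHomogeneous ψ := fun X T hX hT => by
    simp only [ψ]
    rw [density_mul_right, rightAverage_orientation_mul g hX hT, mul_assoc]
  have key := lintegral_stiefelMeasure_comp_mul_left h hB hψ hom
  have hpos : 0 < (‖B.det‖ ^ (2 * r))⁻¹ := by positivity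
  have hψB (X : Matrix (Fin m) (Fin r) ℂ) : ψ (B * X) =
      ENNReal.ofReal (‖B.det‖ ^ (2 * r))⁻¹ *
        (density P X * rightAverage g (orientation (B * X))) := by
    simp only [ψ]
    rw [density_mul_left hB, mul_assoc]
  simp_rw [hψB] at key
  rw [lintegral_const_mul' _ _ ENNReal.ofReal_ne_top, ENNReal.mul_right_inj
    (ENNReal.ofReal_pos.mpr hpos).ne' ENNReal.ofReal_ne_top] at key
  rw [lintegral_cmacg h P havB, key, ← lintegral_cmacg h _ hav]
  -- The law is carried by frames, on which the orientation map is the identity.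
  refine lintegral_congr_ae ?_
  filter_upwards [ae_mem_stiefel_cmacg h (B * P * Bᴴ)] with H hH
  rw [orientation_of_mem_stiefel hH]

end CMACG

/-! ### Transfer of the law from `H_Z` to `H_Y`. -/

theorem mainTheorem4 {m r : ℕ} (hrm : r ≤ m)
    {Ω : Type*} [MeasurableSpace Ω] (μ : Measure Ω) [IsProbabilityMeasure μ]
    (Z : Ω → Matrix (Fin m) (Fin r) ℂ)
    -- `Z` has a density `f` with respect to Lebesgue measure ...
    (f : Matrix (Fin m) (Fin r) ℂ → ℝ≥0∞) (hf : Measurable f)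
    (hZ : HasLaw Z ((CMACG.lebesgue m r).withDensity f) μ)
    -- ... which is invariant under right unitary transformations
    (hinv : ∀ Q ∈ unitaryGroup (Fin r) ℂ, ∀ᵐ X ∂(CMACG.lebesgue m r), f (X * Q) = f X)
    (B : Matrix (Fin m) (Fin m) ℂ) (hB : B.det ≠ 0)
    (P : Matrix (Fin m) (Fin m) ℂ) (hP : P.PosDef)
    (hH : HasLaw (fun ω => CMACG.orientation (Z ω)) (CMACG.cmacg hrm P) μ) :
    HasLaw (fun ω => CMACG.orientation (B * Z ω)) (CMACG.cmacg hrm (B * P * Bᴴ)) μ := by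
  have hor : Measurable fun X : Matrix (Fin m) (Fin r) ℂ => CMACG.orientation (B * X) :=
    CMACG.measurable_orientation.comp (Continuous.measurable (by fun_prop))
  have hae : AEMeasurable (fun ω => CMACG.orientation (B * Z ω)) μ :=
    hor.comp_aemeasurable hZ.aemeasurable
  refine ⟨hae, Measure.ext_of_lintegral _ fun g hg => ?_⟩
  have hav := CMACG.measurable_rightAverage hg
  -- Full rank follows from the assumed law of `H_Z`, which is carried by frames, with no appeal to
  -- the density of `Z`.
  have hfull : ∀ᵐ ω ∂μ, ((Z ω)ᴴ * Z ω).det ≠ 0 := by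
    have h := CMACG.ae_mem_stiefel_cmacg hrm P
    rw [← hH.map_eq] at h
    filter_upwards [ae_of_ae_map hH.aemeasurable h] with ω hω
    exact CMACG.det_gram_ne_zero_of_orientation_mem_stiefel hω
  calc ∫⁻ H, g H ∂μ.map (fun ω => CMACG.orientation (B * Z ω))
      = ∫⁻ ω, g (CMACG.orientation (B * Z ω)) ∂μ := lintegral_map' hg.aemeasurable hae
    _ = ∫⁻ X, g (CMACG.orientation (B * X)) ∂(CMACG.lebesgue m r).withDensity f := by
        rw [← hZ.map_eq]
        exact (lintegral_map' (hg.comp hor).aemeasurable hZ.aemeasurable).symm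
    _ = ∫⁻ ω, CMACG.rightAverage g (CMACG.orientation (B * Z ω)) ∂μ := by
        rw [CMACG.lintegral_withDensity_orientation_rightAverage hf hinv B hg, ← hZ.map_eq]
        exact lintegral_map' (hav.comp hor).aemeasurable hZ.aemeasurable
    _ = ∫⁻ ω, CMACG.rightAverage g (CMACG.orientation (B * CMACG.orientation (Z ω))) ∂μ := by
        refine lintegral_congr_ae ?_
        filter_upwards [hfull] with ω hω
        have hst : ((CMACG.orientation (Z ω))ᴴ * CMACG.orientation (Z ω)).det ≠ 0 := by
          have h1 : (CMACG.orientation (Z ω))ᴴ * CMACG.orientation (Z ω) = 1 :=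
            CMACG.orientation_mem_stiefel hω
          rw [h1, det_one]
          exact one_ne_zero
        -- Take `T` to be the root of the Gram matrix of `Z`, so that `(B H_Z) T = B Z`; the average
        -- ignores the resulting unitary factor.
        rw [← CMACG.rightAverage_orientation_mul g
          ((CMACG.det_gram_mul_left_ne_zero_iff hB).mpr hst) (CMACG.det_sqrt_gram_ne_zero hω),
          Matrix.mul_assoc, CMACG.orientation_mul_sqrt hω]
    _ = ∫⁻ H, CMACG.rightAverage g (CMACG.orientation (B * H)) ∂CMACG.cmacg hrm P := by
        rw [← hH.map_eq]
        exact (lintegral_map' (hav.comp hor).aemeasurable hH.aemeasurable).symm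
    _ = ∫⁻ H, CMACG.rightAverage g H ∂CMACG.cmacg hrm (B * P * Bᴴ) :=
        CMACG.lintegral_cmacg_rightAverage_orientation_mul hrm hB P hg
    _ = ∫⁻ H, g H ∂CMACG.cmacg hrm (B * P * Bᴴ) :=
        CMACG.lintegral_cmacg_rightAverage hrm _ hg
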